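/- Let $n\ge 1$ and let $G\subseteq\binom{[n]}{2}$ be a simple graph on the vertex set $[n]=\{1,\dots,n\}$; edges are written $ij$ with $i<j$. The deleted Shi and Ish arrangements of $G$ are the hyperplane arrangements in $\mathbb{R}^n$ $$\mathsf{Shi}(G)=\{x_i-x_j=0: 1\le i<j\le n\}\cup\{x_i-x_j=1: ij\in G\},$$ $$\mathsf{Ish}(G)=\{x_i-x_j=0: 1\le i<j\le n\}\cup\{x_1-x_j=i: ij\in G\}.$$ The characteristic polynomial of a finite arrangement $\mathcal{A}$ of hyperplanes in $\mathbb{R}^n$ is $\chi_{\mathcal A}(p)=\sum_{X}\mu(\mathbb{R}^n,X)\,p^{\dim X}\in\mathbb{Z}[p]$, where $X$ runs over the nonempty intersections of subfamilies of $\mathcal{A}$ (including $\mathbb{R}^n$, the empty intersection), ordered by reverse inclusion, and $\mu$ is the Möbius function of this poset. An arc of a set partition $\pi$ of $[n]$ is a pair $ij$ with $i<j$ such that $i$ and $j$ lie in the same block of $\pi$ and no $\ell$ with $i<\ell<j$ lies in that block; $\pi$ is a $G$-partition if all its arcs are edges of $G$; and $\mathrm{Stir}(G,m)$ denotes the number of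 $G$-partitions of $[n]$ with exactly $m$ blocks. Then $\mathsf{Shi}(G)$ and $\mathsf{Ish}(G)$ have the same characteristic polynomial, namely $$\chi_{\mathsf{Shi}(G)}(p)=\chi_{\mathsf{Ish}(G)}(p)=p\sum_{k=0}^{n-1}(-1)^k\,\mathrm{Stir}(G,n-k)\,\frac{(p-k-1)!}{(p-n)!},$$ where $\frac{(p-k-1)!}{(p-n)!}$ stands for the polynomial $(p-k-1)(p-k-2)\cdots(p-n+1)=\prod_{i=k+1}^{n-1}(p-i)$. In particular the displayed formula holds literally, with factorials, for every integer $p\ge n$. -/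

import Mathlib

namespace ShiIsh

/-- The affine hyperplane `x_i - x_j = c` in `ℝⁿ`. -/
def hyperplane {n : ℕ} (i j : Fin n) (c : ℝ) : AffineSubspace ℝ (Fin n → ℝ) where
  carrier := {x | x i - x j = c}
  smul_vsub_vadd_mem' := by
    intro t x y z hx hy hz
    simp only [Set.mem_ofPred_eq, vsub_eq_sub, vadd_eq_add, Pi.add_apply, Pi.smul_apply,
      Pi.sub_apply, smul_eq_mul] at *
    linear_combination t * hx - t * hy + hz

open Classical in
/-- The Coxeter arrangement `{x_i - x_j = 0 : 1 ≤ i < j ≤ n}`. -/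
noncomputable def coxeter (n : ℕ) : Finset (AffineSubspace ℝ (Fin n → ℝ)) :=
  (Finset.univ.filter fun e : Fin n × Fin n => e.1 < e.2).image
    fun e => hyperplane e.1 e.2 0

open Classical in
/-- The deleted Shi arrangement: the Coxeter arrangement together with the hyperplanes
`x_i - x_j = 1` for the edges `ij` of `G` with `i < j`. -/
noncomputable def shi {n : ℕ} (G : SimpleGraph (Fin n)) :
    Finset (AffineSubspace ℝ (Fin n → ℝ)) :=
  coxeter n ∪ (Finset.univ.filter fun e : Fin n × Fin n => e.1 < e.2 ∧ G.Adj e.1 e.2).image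
    fun e => hyperplane e.1 e.2 1

open Classical in
/-- The deleted Ish arrangement: the Coxeter arrangement together with the hyperplanes
`x_1 - x_j = i` for the edges `ij` of `G` with `i < j`. The vertices `1, …, n` are the elements
`0, …, n - 1` of `Fin n`, so that the first coordinate has index `0` and the number that the
vertex `i` stands for is `i + 1`. -/
noncomputable def ish {n : ℕ} [NeZero n] (G : SimpleGraph (Fin n)) :
    Finset (AffineSubspace ℝ (Fin n → ℝ)) :=
  coxeter n ∪ (Finset.univ.filter fun e : Fin n × Fin n => e.1 < e.2 ∧ G.Adj e.1 e.2).image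
    fun e => hyperplane 0 e.2 ((e.1 : ℕ) + 1 : ℝ)

open Classical in
/-- The nonempty intersections of subfamilies of the arrangement `A` (the empty subfamily has
intersection `⊤`, the whole space). -/
noncomputable def flats {n : ℕ} (A : Finset (AffineSubspace ℝ (Fin n → ℝ))) :
    Finset (AffineSubspace ℝ (Fin n → ℝ)) :=
  (A.powerset.image fun S => S.inf id).filter fun X => X ≠ ⊥

theorem top_mem_flats {n : ℕ} (A : Finset (AffineSubspace ℝ (Fin n → ℝ))) : ⊤ ∈ flats A := by
  classical
  simp only [flats, Finset.mem_filter, Finset.mem_image, Finset.mem_powerset]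
  exact ⟨⟨∅, Finset.empty_subset _, Finset.inf_empty⟩, top_ne_bot⟩

/-- The intersection poset of `A`: nonempty intersections, ordered by reverse inclusion. -/
abbrev IntersectionPoset {n : ℕ} (A : Finset (AffineSubspace ℝ (Fin n → ℝ))) : Type :=
  {X : AffineSubspace ℝ (Fin n → ℝ) // X ∈ flats A}ᵒᵈ

/-- The whole space, as the minimum of the intersection poset. -/
def whole {n : ℕ} (A : Finset (AffineSubspace ℝ (Fin n → ℝ))) : IntersectionPoset A :=
  OrderDual.toDual ⟨⊤, top_mem_flats A⟩

open Classical in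
noncomputable instance {n : ℕ} (A : Finset (AffineSubspace ℝ (Fin n → ℝ))) :
    LocallyFiniteOrder (IntersectionPoset A) :=
  Fintype.toLocallyFiniteOrder

open Classical in
/-- The characteristic polynomial `∑_X μ(ℝⁿ, X) p^{dim X}` of the arrangement `A`, where `X` runs
over the intersection poset and `μ` is its Möbius function. -/
noncomputable def charPoly {n : ℕ} (A : Finset (AffineSubspace ℝ (Fin n → ℝ))) :
    Polynomial ℤ :=
  ∑ X : IntersectionPoset A,
    Polynomial.C (IncidenceAlgebra.mu ℤ (whole A) X) *
      Polynomial.X ^ Module.finrank ℝ (OrderDual.ofDual X).1.direction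

/-- The pair `ij` is an arc of the set partition `π`: `i < j` are consecutive elements of a
block. -/
def IsArc {n : ℕ} (π : Finpartition (Finset.univ : Finset (Fin n))) (i j : Fin n) : Prop :=
  i < j ∧ ∃ B ∈ π.parts, i ∈ B ∧ j ∈ B ∧ ∀ l ∈ B, ¬ (i < l ∧ l < j)

/-- A set partition is a `G`-partition if all of its arcs are edges of `G`. -/
def IsGPartition {n : ℕ} (G : SimpleGraph (Fin n))
    (π : Finpartition (Finset.univ : Finset (Fin n))) : Prop :=
  ∀ i j, IsArc π i j → G.Adj i j

/-- The `G`-Stirling number: the number of `G`-partitions with `k` blocks. -/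
noncomputable def stir {n : ℕ} (G : SimpleGraph (Fin n)) (k : ℕ) : ℕ :=
  Nat.card {π : Finpartition (Finset.univ : Finset (Fin n)) //
    IsGPartition G π ∧ π.parts.card = k}

end ShiIsh

namespace ShiIsh

/-! The finite field method, over `ZMod q` for every large integer `q` rather than only primes:
`charPoly` at `q` is the number of points of `(ℤ/q)ⁿ` off all hyperplanes taken mod `q`
(`charPoly_eval_eq_card_zmod`). For both arrangements these points are the injective maps `Fin n →
ZMod q` violating one further equation per edge of `G`, so they are counted by inclusion–exclusion
over sets `S` of edges.

If two edges of `S` share a left end or share a right end, their equations contradict injectivity.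
Otherwise `S` is a rook set, and the number of injective solutions depends only on `S.card`, by the
same formula for Ish (`card_ish_constraints`) and for Shi (`card_circlePlacement`). Rook sets of `k`
edges are exactly the arc sets of `G`-partitions with `n - k` blocks (`stir_eq_card_rook`). Hence
both polynomials agree with `stirPoly` at infinitely many integers. -/

/-! ### The finite field method modulo an arbitrary large integer. -/

theorem mem_finset_inf {n : ℕ} {T : Finset (AffineSubspace ℝ (Fin n → ℝ))} {x : Fin n → ℝ} :
    x ∈ T.inf id ↔ ∀ H ∈ T, x ∈ H := by
  classical
  induction T using Finset.induction_on with
  | empty => simp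
  | insert a T ha ih =>
    rw [Finset.inf_insert, AffineSubspace.mem_inf_iff, ih, Finset.forall_mem_insert]
    rfl

open Classical in
-- By `h`, the value at `q` counts pairs `(X, z)` with `φ z ∈ X`, weighted by `μ`. For fixed `z`,
-- the flats through `φ z` form an interval from the whole space to the intersection of all
-- hyperplanes through `φ z`. The Möbius sum over it vanishes unless the interval is a single point,
-- which by `hA` means that no hyperplane contains `φ z`.
theorem charPoly_eval_eq_card {n : ℕ} (A : Finset (AffineSubspace ℝ (Fin n → ℝ)))
    (hA : ⊤ ∉ A) {Z : Type*} [Fintype Z] (φ : Z → Fin n → ℝ) (q : ℕ)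
    (h : ∀ X ∈ flats A, (Finset.univ.filter fun z => φ z ∈ X).card =
      q ^ Module.finrank ℝ X.direction) :
    (charPoly A).eval (q : ℤ) = (Finset.univ.filter fun z => ∀ H ∈ A, φ z ∉ H).card := by
  have h1 : (charPoly A).eval (q : ℤ) = ∑ X : IntersectionPoset A, ∑ z : Z,
      if φ z ∈ (OrderDual.ofDual X).1 then IncidenceAlgebra.mu ℤ (whole A) X else 0 := by
    rw [charPoly, Polynomial.eval_finsetSum]
    refine Finset.sum_congr rfl fun X _ => ?_
    rw [Polynomial.eval_mul, Polynomial.eval_C, Polynomial.eval_pow, Polynomial.eval_X,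
      ← Finset.sum_filter, Finset.sum_const, h _ (OrderDual.ofDual X).2]
    rw [nsmul_eq_mul, mul_comm]
    push_cast
    rfl
  rw [h1, Finset.sum_comm, Finset.card_filter]
  push_cast
  refine Finset.sum_congr rfl fun z _ => ?_
  set S := A.filter fun H => φ z ∈ H with hS
  have hmem : φ z ∈ S.inf id :=
    mem_finset_inf.2 fun H hH => (Finset.mem_filter.1 hH).2
  have hflat : S.inf id ∈ flats A := by
    rw [flats, Finset.mem_filter]
    refine ⟨Finset.mem_image.2 ⟨S, by simp [hS], rfl⟩, fun hb => ?_⟩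
    rw [hb] at hmem
    exact hmem
  let Y : IntersectionPoset A := OrderDual.toDual ⟨S.inf id, hflat⟩
  have hIcc : (Finset.univ.filter fun X : IntersectionPoset A => φ z ∈ (OrderDual.ofDual X).1) =
      Finset.Icc (whole A) Y := by
    ext X
    rw [Finset.mem_filter, Finset.mem_Icc]
    constructor
    · rintro ⟨-, hX⟩
      refine ⟨?_, ?_⟩
      · change (OrderDual.ofDual X).1 ≤ ⊤
        exact le_top
      · change S.inf id ≤ (OrderDual.ofDual X).1
        have hXf : (OrderDual.ofDual X).1 ∈ flats A := (OrderDual.ofDual X).2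
        obtain ⟨T, hT, hTX⟩ := Finset.mem_image.1 (Finset.mem_filter.1 hXf).1
        rw [← hTX]
        refine Finset.inf_mono fun H hH => Finset.mem_filter.2 ⟨Finset.mem_powerset.1 hT hH, ?_⟩
        have : T.inf id ≤ H := Finset.inf_le (f := id) hH
        rw [← hTX] at hX
        exact this hX
    · rintro ⟨-, hX⟩
      have hX' : S.inf id ≤ (OrderDual.ofDual X).1 := hX
      exact ⟨Finset.mem_univ _, hX' hmem⟩
  rw [← Finset.sum_filter, hIcc]
  rw [IncidenceAlgebra.sum_Icc_mu_right]
  refine if_congr ?_ rfl rfl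
  constructor
  · intro hY H hH hz
    have h2 : S.inf id = ⊤ := (congrArg (fun X : IntersectionPoset A => (OrderDual.ofDual X).1) hY).symm
    have : S.inf id ≤ H := Finset.inf_le (f := id) (Finset.mem_filter.2 ⟨hH, hz⟩)
    rw [h2, top_le_iff] at this
    exact hA (this ▸ hH)
  · intro hA
    have : S = ∅ := Finset.filter_eq_empty_iff.2 fun H hH => hA H hH
    have h2 : S.inf id = ⊤ := by rw [this, Finset.inf_empty]
    exact congrArg OrderDual.toDual (Subtype.ext h2.symm)

theorem mem_hyperplane {n : ℕ} {i j : Fin n} {c : ℝ} {x : Fin n → ℝ} :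
    x ∈ hyperplane i j c ↔ x i - x j = c := Iff.rfl

/-- Cutting the circle `ℤ/q` at a long gap lifts a configuration of points to the integers. -/
theorem exists_lift {n K q : ℕ} (hq : n * K < q) (z : Fin n → ZMod q) :
    ∃ x : Fin n → ℤ, ∀ i j, ∀ c : ℤ, |c| ≤ K → (x i - x j = c ↔ z i - z j = c) := by
  have : NeZero q := ⟨by omega⟩
  -- The `K` positions after each of the `n` points cannot cover all `q > n * K` residues. Cutting
  -- at an uncovered `a` leaves the last `K` positions before the cut empty.
  obtain ⟨a, ha⟩ : ∃ a : ZMod q, ∀ i : Fin n, ∀ t : Fin K, a ≠ z i + ((t : ℕ) + 1 : ℕ) := by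
    by_contra! hcon
    have hs : Function.Surjective fun p : Fin n × Fin K => z p.1 + ((p.2 : ℕ) + 1 : ℕ) := by
      intro a
      obtain ⟨i, t, h⟩ := hcon a
      exact ⟨(i, t), h.symm⟩
    have := Fintype.card_le_of_surjective _ hs
    rw [ZMod.card, Fintype.card_prod, Fintype.card_fin, Fintype.card_fin] at this
    omega
  have hval : ∀ i, (z i - a).val + K < q := by
    intro i
    by_contra! hlt
    have h1 := ZMod.val_lt (z i - a)
    refine ha i ⟨q - (z i - a).val - 1, by omega⟩ ?_
    have h2 : q - (z i - a).val - 1 + 1 = q - (z i - a).val := by omega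
    rw [h2, Nat.cast_sub h1.le]
    simp
  refine ⟨fun i => (z i - a).val, fun i j c hc => ?_⟩
  have hz : z i - z j = (((z i - a).val - (z j - a).val : ℤ) : ZMod q) := by
    push_cast
    simp
  constructor
  · intro h
    rw [hz, h]
  · intro h
    rw [hz, ZMod.intCast_eq_intCast_iff_dvd_sub] at h
    change ((z i - a).val : ℤ) - (z j - a).val = c
    -- Lifted differences are smaller than `q - K` in absolute value and `|c| ≤ K`, so a congruence
    -- mod `q` is an equality.
    have h0 := Int.eq_zero_of_abs_lt_dvd h (by
      have := hval i
      have := hval j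
      rw [abs_le] at hc
      rw [abs_lt]
      constructor <;> omega)
    omega

theorem card_constant_on {V M : Type*} [Fintype V] [Fintype M] (R : V → V → Prop) :
    Nat.card {v : V → M // ∀ i j, R i j → v i = v j} = Fintype.card M ^ Nat.card (Quot R) := by
  have e : {v : V → M // ∀ i j, R i j → v i = v j} ≃ (Quot R → M) :=
    { toFun := fun v => Quot.lift v.1 v.2
      invFun := fun f => ⟨fun i => f (Quot.mk R i), fun i j h => congrArg f (Quot.sound h)⟩
      left_inv := fun v => rfl
      right_inv := fun f => by ext x; induction x using Quot.ind; rfl }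
  rw [Nat.card_congr e, Nat.card_fun, Nat.card_eq_fintype_card]

/-- Translating by `x` makes the equations homogeneous: the direction consists of the functions
constant on the classes generated by `R`. The same quotient is the exponent in `card_constant_on`.
-/
theorem finrank_direction_eq {n : ℕ} (R : Fin n → Fin n → Prop) (X : AffineSubspace ℝ (Fin n → ℝ))
    (x : Fin n → ℝ) (hX : ∀ y, y ∈ X ↔ ∀ i j, R i j → y i - x i = y j - x j) :
    Module.finrank ℝ X.direction = Nat.card (Quot R) := by
  have hx : x ∈ X := (hX x).2 fun i j _ => by simp
  have : X.direction = LinearMap.range (LinearMap.funLeft ℝ ℝ (Quot.mk R)) := by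
    ext v
    rw [← AffineSubspace.vadd_mem_iff_mem_direction v hx, hX, LinearMap.mem_range]
    simp only [vadd_eq_add, Pi.add_apply, add_sub_cancel_right]
    constructor
    · intro h
      exact ⟨Quot.lift v h, rfl⟩
    · rintro ⟨f, rfl⟩ i j h
      exact congrArg f (Quot.sound h)
  have : Finite (Quot R) := Finite.of_surjective _ Quot.mk_surjective
  have := Fintype.ofFinite (Quot R)
  rw [‹X.direction = _›, LinearMap.finrank_range_of_inj
    (LinearMap.funLeft_injective_of_surjective ℝ ℝ _ Quot.mk_surjective), Module.finrank_pi,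
    Nat.card_eq_fintype_card]


/-- The arrangement of the hyperplanes `x_i - x_j = c` for the triples `(i, j, c)` in `E`. -/
noncomputable def arrangement {n : ℕ} (E : Set (Fin n × Fin n × ℤ)) :
    Set (AffineSubspace ℝ (Fin n → ℝ)) :=
  (fun e => hyperplane e.1 e.2.1 (e.2.2 : ℝ)) '' E

open Classical in
-- The integer lifts from `exists_lift` serve as `φ`. A flat has as many solutions mod `q` as
-- required because it contains an integer point, and subtracting that point leaves the functions
-- constant on the classes of its equations.
theorem charPoly_eval_eq_card_zmod {n K q : ℕ} (hq : n * K < q) [NeZero q]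
    (A : Finset (AffineSubspace ℝ (Fin n → ℝ)))
    (E : Set (Fin n × Fin n × ℤ)) (hE : ∀ e ∈ E, e.1 ≠ e.2.1 ∧ |e.2.2| ≤ K)
    (hA : (A : Set _) = arrangement E) :
    (charPoly A).eval (q : ℤ) =
      Nat.card {z : Fin n → ZMod q // ∀ e ∈ E, z e.1 - z e.2.1 ≠ e.2.2} := by
  choose φ hφ using fun z : Fin n → ZMod q => exists_lift hq z
  have hmem : ∀ z, ∀ e ∈ E,
      ((fun i => (φ z i : ℝ)) ∈ hyperplane e.1 e.2.1 (e.2.2 : ℝ) ↔ z e.1 - z e.2.1 = e.2.2) := by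
    intro z e he
    rw [mem_hyperplane, ← hφ z _ _ _ (hE e he).2]
    norm_cast
  rw [Nat.card_eq_fintype_card, Fintype.card_subtype, charPoly_eval_eq_card A _ (fun z i => (φ z i : ℝ)) q]
  · congr 2
    ext z
    simp only [Finset.mem_filter, Finset.mem_univ, true_and]
    constructor
    · intro h e he hz
      refine h (hyperplane e.1 e.2.1 e.2.2) ?_ ((hmem z e he).2 hz)
      rw [← Finset.mem_coe, hA]
      exact ⟨e, he, rfl⟩
    · intro h H hH hz
      rw [← Finset.mem_coe, hA] at hH
      obtain ⟨e, he, rfl⟩ := hH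
      exact h e he ((hmem z e he).1 hz)
  · intro X hX
    rw [flats, Finset.mem_filter, Finset.mem_image] at hX
    obtain ⟨⟨S, hS, hSX⟩, hne⟩ := hX
    have hXmem : ∀ y, y ∈ X ↔ ∀ e ∈ E, hyperplane e.1 e.2.1 (e.2.2 : ℝ) ∈ S →
        y e.1 - y e.2.1 = e.2.2 := by
      intro y
      rw [← hSX, mem_finset_inf]
      constructor
      · intro h e _ heS
        exact h _ heS
      · intro h H hH
        have := Finset.mem_powerset.1 hS hH
        rw [← Finset.mem_coe, hA] at this
        obtain ⟨e, he, rfl⟩ := this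
        exact h e he hH
    obtain ⟨x, hx⟩ := (AffineSubspace.nonempty_iff_ne_bot X).2 hne
    -- All prescribed differences are integers, so taking floors turns a real point of the flat into
    -- an integer one.
    have hfloor : ∀ e ∈ E, hyperplane e.1 e.2.1 (e.2.2 : ℝ) ∈ S →
        ⌊x e.1⌋ - ⌊x e.2.1⌋ = e.2.2 := by
      intro e he heS
      have := (hXmem x).1 hx e he heS
      rw [show x e.1 = x e.2.1 + e.2.2 by linarith, Int.floor_add_intCast]
      ring
    set R : Fin n → Fin n → Prop := fun i j =>
      ∃ c : ℤ, (i, j, c) ∈ E ∧ hyperplane i j (c : ℝ) ∈ S with hR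
    rw [finrank_direction_eq R X x]
    · have := card_constant_on (M := ZMod q) R
      rw [ZMod.card] at this
      rw [← this, ← Fintype.card_subtype, ← Nat.card_eq_fintype_card]
      refine Nat.card_congr ((Equiv.subRight fun i => ((⌊x i⌋ : ℤ) : ZMod q)).subtypeEquiv ?_)
      intro z
      rw [hXmem]
      simp only [Equiv.subRight_apply, Pi.sub_apply]
      constructor
      · rintro h i j ⟨c, hc, hcS⟩
        have h1 := (hmem z _ hc).1 (h _ hc hcS)
        have h2 := congrArg (Int.cast : ℤ → ZMod q) (hfloor _ hc hcS)
        push_cast at h2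
        linear_combination h1 - h2
      · intro h e he heS
        refine (hmem z e he).2 ?_
        have h1 := h e.1 e.2.1 ⟨e.2.2, he, heS⟩
        have h2 := congrArg (Int.cast : ℤ → ZMod q) (hfloor _ he heS)
        push_cast at h2
        linear_combination h1 + h2
    · intro y
      rw [hXmem]
      constructor
      · rintro h i j ⟨c, hc, hcS⟩
        have h1 := h _ hc hcS
        have h2 := (hXmem x).1 hx _ hc hcS
        simp only at h1 h2
        linarith
      · intro h e he heS
        have h1 := h e.1 e.2.1 ⟨e.2.2, he, heS⟩
        have h2 := (hXmem x).1 hx _ he heS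
        linarith
  · intro htop
    rw [← Finset.mem_coe, hA] at htop
    obtain ⟨e, he, htop⟩ := htop
    have h0 : ∀ x : Fin n → ℝ, x e.1 - x e.2.1 = e.2.2 := fun x => by
      rw [← mem_hyperplane]
      change x ∈ (fun e : Fin n × Fin n × ℤ => hyperplane e.1 e.2.1 (e.2.2 : ℝ)) e
      rw [htop]
      exact AffineSubspace.mem_top _ _ _
    have h1 := h0 0
    have h2 := h0 (Pi.single e.1 1)
    rw [Pi.single_eq_same, Pi.single_eq_of_ne (hE e he).1.symm] at h2
    simp only [Pi.zero_apply] at h1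
    linarith

/-! ### Inclusion–exclusion and the count for Ish constraints. -/

/-- Inclusion–exclusion over the conditions `P e`, `e ∈ E`. -/
theorem card_forall_not {Ω ι : Type*} [Fintype Ω] (E : Finset ι) (Q : Ω → Prop)
    (P : ι → Ω → Prop) :
    (Nat.card {x // Q x ∧ ∀ e ∈ E, ¬ P e x} : ℤ) =
      ∑ S ∈ E.powerset, (-1) ^ S.card * (Nat.card {x // Q x ∧ ∀ e ∈ S, P e x} : ℤ) := by
  classical
  simp_rw [Nat.card_eq_fintype_card, Fintype.card_subtype, Finset.card_filter]
  push_cast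
  simp_rw [Finset.mul_sum]
  rw [Finset.sum_comm]
  refine Finset.sum_congr rfl fun x _ => ?_
  by_cases hQ : Q x
  · have h1 : ∀ T : Finset ι, ∀ p : ι → Prop, ∀ _ : Decidable (Q x ∧ ∀ e ∈ T, p e),
        (if Q x ∧ ∀ e ∈ T, p e then (1 : ℤ) else 0) =
        ∏ e ∈ T, if p e then 1 else 0 := by
      intro T p _
      rw [Finset.prod_ite_zero]
      simp [hQ]
    have h2 : ∀ e, ∀ _ : Decidable (¬ P e x), (if ¬ P e x then (1 : ℤ) else 0) = 1 - if P e x then 1 else 0 := by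
      intro e _
      split_ifs <;> simp_all
    rw [h1]
    simp_rw [h2, h1]
    simp_rw [sub_eq_add_neg, Finset.prod_one_add, Finset.prod_neg]
  · simp [hQ]

/-- A set of pairs in which no two pairs share their first or their second component. -/
def IsRook {V : Type*} (S : Finset (V × V)) : Prop :=
  Set.InjOn Prod.fst (S : Set (V × V)) ∧ Set.InjOn Prod.snd (S : Set (V × V))

/-- Injective maps with prescribed values on a set `U`. -/
theorem card_injective_extensions {V B : Type*} [Fintype V] [Fintype B] [DecidableEq V]
    (U : Finset V) (g : V → B) (hg : Set.InjOn g U) :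
    Nat.card {x : V → B // Function.Injective x ∧ ∀ v ∈ U, x v = g v} =
      (Fintype.card B - U.card).descFactorial (Fintype.card V - U.card) := by
  classical
  have e : {x : V → B // Function.Injective x ∧ ∀ v ∈ U, x v = g v} ≃
      ({v // v ∉ U} ↪ {b // b ∉ U.image g}) :=
    { toFun := fun x => ⟨fun v => ⟨x.1 v, fun h => by
          obtain ⟨u, hu, huv⟩ := Finset.mem_image.1 h
          rw [← x.2.2 u hu] at huv
          exact v.2 (x.2.1 huv ▸ hu)⟩, fun v w h => Subtype.ext (x.2.1 (congrArg Subtype.val h))⟩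
      invFun := fun f => ⟨fun v => if h : v ∈ U then g v else f ⟨v, h⟩, by
        constructor
        · intro v w h
          by_cases hv : v ∈ U <;> by_cases hw : w ∈ U <;> simp only [hv, hw, dite_true, dite_false] at h
          · exact hg hv hw h
          · exact ((f ⟨w, hw⟩).2 (h ▸ Finset.mem_image_of_mem g hv)).elim
          · exact ((f ⟨v, hv⟩).2 (h ▸ Finset.mem_image_of_mem g hw)).elim
          · exact congrArg Subtype.val (f.injective (Subtype.ext h))
        · intro v hv
          simp [hv]⟩
      left_inv := fun x => by
        ext v
        by_cases hv : v ∈ U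
        · simp [hv, x.2.2 v hv]
        · simp only [hv, dite_false]
          rfl
      right_inv := fun f => by
        ext v
        simp [v.2] }
  rw [Nat.card_congr e, Nat.card_eq_fintype_card, Fintype.card_embedding_eq,
    Fintype.card_subtype_compl, Fintype.card_subtype_compl, Fintype.card_coe, Fintype.card_coe,
    Finset.card_image_of_injOn hg]

theorem natCast_zmod_inj {q a b : ℕ} (ha : a < q) (hb : b < q) (h : (a : ZMod q) = b) : a = b := by
  rw [ZMod.natCast_eq_natCast_iff', Nat.mod_eq_of_lt ha, Nat.mod_eq_of_lt hb] at h
  exact h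

/-- The value `c` of `x 0` is free and forces `x e.2 = c - (e.1 + 1)` for `e ∈ S`. Distinct second
components make this consistent, distinct first components make the forced values distinct, and `0 <
e.1 + 1 < q` keeps them away from `c`. The other coordinates are injected into the unused residues.
-/
theorem card_ish_constraints {n q : ℕ} [NeZero n] (hq : n < q) (S : Finset (Fin n × Fin n))
    (hlt : ∀ e ∈ S, e.1 < e.2) (hS : IsRook S) :
    Nat.card {x : Fin n → ZMod q // Function.Injective x ∧
        ∀ e ∈ S, x 0 - x e.2 = ((e.1 : ℕ) + 1 : ℕ)} =
      q * (q - 1 - S.card).descFactorial (n - 1 - S.card) := by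
  classical
  have : NeZero q := ⟨by omega⟩
  have h0 : ∀ e ∈ S, e.2 ≠ 0 := fun e he h => by
    have := hlt e he
    rw [h] at this
    exact absurd this (Fin.not_lt_zero _)
  set U : Finset (Fin n) := insert 0 (S.image Prod.snd) with hU
  have hUcard : U.card = S.card + 1 := by
    rw [hU, Finset.card_insert_of_notMem, Finset.card_image_of_injOn hS.2]
    intro h
    obtain ⟨e, he, h⟩ := Finset.mem_image.1 h
    exact h0 e he h
  -- The default offset `0` away from second components of `S` is never used: `g` is only evaluated
  -- on `U`.
  obtain ⟨s, hs⟩ : ∃ s : Fin n → ℕ, ∀ e ∈ S, s e.2 = e.1 + 1 := by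
    refine ⟨fun j => if h : ∃ e ∈ S, e.2 = j then (h.choose.1 : ℕ) + 1 else 0, fun e he => ?_⟩
    have h : ∃ e' ∈ S, e'.2 = e.2 := ⟨e, he, rfl⟩
    beta_reduce
    rw [dif_pos h, hS.2 h.choose_spec.1 he h.choose_spec.2]
  let g : ZMod q → Fin n → ZMod q := fun c j => if j = 0 then c else c - s j
  have hg : ∀ c, Set.InjOn (g c) U := by
    have key : ∀ e ∈ S, s e.2 < q ∧ 0 < s e.2 := fun e he => by
      rw [hs e he]
      have := e.1.2
      omega
    intro c j hj k hk hjk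
    rw [Finset.mem_coe, hU, Finset.mem_insert, Finset.mem_image] at hj hk
    rcases hj with rfl | ⟨e, he, rfl⟩ <;> rcases hk with rfl | ⟨f, hf, rfl⟩
    · rfl
    · simp only [g, if_true, h0 f hf, if_false] at hjk
      have : ((s f.2 : ℕ) : ZMod q) = (0 : ℕ) := by push_cast; linear_combination hjk
      have := natCast_zmod_inj (key f hf).1 (by omega) this
      have := (key f hf).2
      omega
    · simp only [g, if_true, h0 e he, if_false] at hjk
      have : ((s e.2 : ℕ) : ZMod q) = (0 : ℕ) := by push_cast; linear_combination -hjk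
      have := natCast_zmod_inj (key e he).1 (by omega) this
      have := (key e he).2
      omega
    · simp only [g, h0 e he, h0 f hf, if_false] at hjk
      have : ((s e.2 : ℕ) : ZMod q) = (s f.2 : ℕ) := by linear_combination -hjk
      have := natCast_zmod_inj (key e he).1 (key f hf).1 this
      rw [hs e he, hs f hf] at this
      exact congrArg Prod.snd (hS.1 he hf (Fin.ext (by omega)))
  have e : {x : Fin n → ZMod q // Function.Injective x ∧
        ∀ e ∈ S, x 0 - x e.2 = ((e.1 : ℕ) + 1 : ℕ)} ≃
      (c : ZMod q) × {x : Fin n → ZMod q // Function.Injective x ∧ ∀ v ∈ U, x v = g c v} :=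
    { toFun := fun x => ⟨x.1 0, x.1, x.2.1, fun v hv => by
        rw [hU, Finset.mem_insert, Finset.mem_image] at hv
        rcases hv with rfl | ⟨e, he, rfl⟩
        · simp [g]
        · simp only [g, h0 e he, if_false]
          rw [hs e he, ← x.2.2 e he]
          ring⟩
      invFun := fun p => ⟨p.2.1, p.2.2.1, fun e he => by
        rw [p.2.2.2 0 (Finset.mem_insert_self _ _), p.2.2.2 e.2
          (Finset.mem_insert_of_mem (Finset.mem_image_of_mem _ he)), ← hs e he]
        simp [g, h0 e he]⟩
      left_inv := fun x => rfl
      right_inv := fun p => by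
        obtain ⟨c, x, hx, hxU⟩ := p
        obtain rfl : x 0 = c := by
          rw [hxU 0 (Finset.mem_insert_self _ _)]
          simp [g]
        rfl }
  rw [Nat.card_congr e, Nat.card_sigma]
  simp_rw [fun c => card_injective_extensions U (g c) (hg c), hUcard, Fintype.card_fin, ZMod.card]
  rw [Finset.sum_const, Finset.card_univ, ZMod.card, smul_eq_mul, Nat.sub_sub, Nat.sub_sub,
    Nat.add_comm 1]

/-! ### The count for Shi constraints: placements on a circle. -/

/-- Placements of the points of `T` on the circle `ℤ/q` in which `e.1` comes directly after `e.2`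
for every pair `e` of `S`. -/
abbrev CirclePlacement {V : Type*} (T : Finset V) (S : Finset (V × V)) (q : ℕ) : Type _ :=
  {x : V → ZMod q // (∀ v ∉ T, x v = 0) ∧ Set.InjOn x T ∧ ∀ e ∈ S, x e.1 = x e.2 + 1}

/-- Placements of the points of `T` on the line `{0, …, q - 1}` with `r` in the last position, in
which `e.1` comes directly after `e.2` for every pair `e` of `S`. -/
abbrev LinePlacement {V : Type*} (T : Finset V) (S : Finset (V × V)) (q : ℕ) (r : V) : Type _ :=
  {x : V → ℕ // (∀ v ∉ T, x v = 0) ∧ Set.InjOn x T ∧ (∀ v ∈ T, x v < q) ∧ x r + 1 = q ∧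
    ∀ e ∈ S, x e.1 = x e.2 + 1}

theorem zmod_val_add_one {q : ℕ} [NeZero q] (u : ZMod q) (hu : u ≠ -1) :
    (u + 1).val = u.val + 1 := by
  have h1 := ZMod.val_lt u
  have h2 : u.val + 1 ≠ q := fun h => hu (by
    have := congrArg (Nat.cast : ℕ → ZMod q) h
    push_cast at this
    rw [ZMod.natCast_zmod_val, ZMod.natCast_self] at this
    linear_combination this)
  have h3 : ((u.val + 1 : ℕ) : ZMod q) = u + 1 := by
    push_cast
    rw [ZMod.natCast_zmod_val]
  rw [← h3, ZMod.val_cast_of_lt (by omega)]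

theorem zmod_val_neg_one_add_one {q : ℕ} [NeZero q] : (-1 : ZMod q).val + 1 = q := by
  obtain ⟨m, rfl⟩ := Nat.exists_eq_succ_of_ne_zero (NeZero.ne q)
  rw [ZMod.val_neg_one]

/-- Rotating by `x r + 1` puts `r` at `-1`, the last position. Since by `hrS` nothing is required to
follow `r`, no constraint wraps around the cut. -/
theorem card_circlePlacement_eq {V : Type*} {T : Finset V} {S : Finset (V × V)} {q : ℕ}
    [NeZero q] {r : V} (hST : ∀ e ∈ S, e.1 ∈ T ∧ e.2 ∈ T) (hr : r ∈ T) (hrS : ∀ e ∈ S, e.2 ≠ r) :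
    Nat.card (CirclePlacement T S q) = q * Nat.card (LinePlacement T S q r) := by
  classical
  have e : CirclePlacement T S q ≃ ZMod q × LinePlacement T S q r :=
    { toFun := fun x => (x.1 r, ⟨fun v => if v ∈ T then (x.1 v - x.1 r - 1).val else 0, by
        obtain ⟨x, hx0, hxT, hxS⟩ := x
        refine ⟨fun v hv => by simp [hv], ?_, ?_, ?_, ?_⟩
        · intro v hv w hw h
          simp only [Finset.mem_coe.1 hv, Finset.mem_coe.1 hw, if_true] at h
          exact hxT hv hw (by linear_combination ZMod.val_injective q h)
        · intro v hv
          simp only [hv, if_true]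
          exact ZMod.val_lt _
        · simp only [hr, if_true, sub_self, zero_sub]
          exact zmod_val_neg_one_add_one
        · intro e he
          simp only [hST e he, if_true]
          rw [← zmod_val_add_one, hxS e he]
          · congr 1
            ring
          · intro h
            exact hrS e he (hxT (hST e he).2 hr (by linear_combination h))⟩)
      invFun := fun p => ⟨fun v => if v ∈ T then (p.2.1 v : ZMod q) + 1 + p.1 else 0, by
        obtain ⟨c, y, hy0, hyT, hyq, hyr, hyS⟩ := p
        refine ⟨fun v hv => by simp [hv], ?_, ?_⟩
        · intro v hv w hw h
          simp only [Finset.mem_coe.1 hv, Finset.mem_coe.1 hw, if_true] at h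
          exact hyT hv hw (natCast_zmod_inj (hyq v hv) (hyq w hw) (by linear_combination h))
        · intro e he
          simp only [hST e he, if_true]
          rw [hyS e he]
          push_cast
          ring⟩
      left_inv := fun x => by
        ext v
        by_cases hv : v ∈ T
        · simp [hv]
        · simp [hv, x.2.1 v hv]
      right_inv := fun p => by
        obtain ⟨c, y, hy0, hyT, hyq, hyr, hyS⟩ := p
        have h0 : (y r : ZMod q) + 1 = 0 := by
          have := congrArg (Nat.cast : ℕ → ZMod q) hyr
          push_cast at this
          rw [this, ZMod.natCast_self]
        refine Prod.ext ?_ (Subtype.ext (funext fun v => ?_))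
        · simp [hr, h0]
        · by_cases hv : v ∈ T
          · simp only [hv, hr, if_true]
            rw [h0, show (y v : ZMod q) + 1 + c - (0 + c) - 1 = y v by ring,
              ZMod.val_cast_of_lt (hyq v hv)]
          · simp [hv, hy0 v hv] }
  rw [Nat.card_congr e, Nat.card_prod, Nat.card_zmod]

/-- With `i` last and directly after `j`, deleting `i` and its position leaves a line one shorter
with `j` last. By `hi` and the rook condition, no other constraint involves `i`. -/
theorem card_linePlacement_erase {V : Type*} [DecidableEq V] {T : Finset V} {S : Finset (V × V)}
    {q : ℕ} {i j : V} (hS : IsRook S) (hST : ∀ e ∈ S, e.1 ∈ T ∧ e.2 ∈ T) (hij : (i, j) ∈ S)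
    (hi : ∀ e ∈ S, e.2 ≠ i) :
    Nat.card (LinePlacement T S (q + 1) i) =
      Nat.card (LinePlacement (T.erase i) (S.erase (i, j)) q j) := by
  have hji : j ≠ i := hi _ hij
  have hne : ∀ e ∈ S.erase (i, j), e ∈ S ∧ e.1 ≠ i ∧ e.2 ≠ i := fun e he =>
    have he' := Finset.mem_erase.1 he
    ⟨he'.2, fun h => he'.1 (hS.1 he'.2 hij h), hi e he'.2⟩
  refine Nat.card_congr
    { toFun := fun x => ⟨Function.update x.1 i 0, ?_⟩
      invFun := fun y => ⟨Function.update y.1 i q, ?_⟩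
      left_inv := ?_
      right_inv := ?_ }
  · obtain ⟨x, hx0, hxT, hxq, hxi, hxS⟩ := x
    have hupd : ∀ v, v ≠ i → Function.update x i 0 v = x v := fun v hv =>
      Function.update_of_ne hv _ _
    refine ⟨fun v hv => ?_, fun v hv w hw h => ?_, fun v hv => ?_, ?_, fun e he => ?_⟩
    · by_cases hvi : v = i
      · rw [hvi, Function.update_self]
      · rw [hupd v hvi]
        exact hx0 v fun h => hv (Finset.mem_erase.2 ⟨hvi, h⟩)
    · obtain ⟨hvi, hv⟩ := Finset.mem_erase.1 hv
      obtain ⟨hwi, hw⟩ := Finset.mem_erase.1 hw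
      rw [hupd v hvi, hupd w hwi] at h
      exact hxT hv hw h
    · obtain ⟨hvi, hv⟩ := Finset.mem_erase.1 hv
      rw [hupd v hvi]
      have h1 := hxq v hv
      have h2 : x v ≠ x i := fun h => hvi (hxT hv (hST _ hij).1 h)
      omega
    · rw [hupd j hji]
      have := hxS _ hij
      simp only at this
      omega
    · obtain ⟨heS, h1, h2⟩ := hne e he
      rw [hupd _ h1, hupd _ h2]
      exact hxS e heS
  · obtain ⟨y, hy0, hyT, hyq, hyj, hyS⟩ := y
    have hupd : ∀ v, v ≠ i → Function.update y i q v = y v := fun v hv =>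
      Function.update_of_ne hv _ _
    have hlt : ∀ v ∈ T, v ≠ i → y v < q := fun v hv hvi => hyq v (Finset.mem_erase.2 ⟨hvi, hv⟩)
    refine ⟨fun v hv => ?_, fun v hv w hw h => ?_, fun v hv => ?_, ?_, fun e he => ?_⟩
    · have hvi : v ≠ i := fun h => hv (h ▸ (hST _ hij).1)
      rw [hupd v hvi]
      exact hy0 v fun h => hv (Finset.mem_of_mem_erase h)
    · by_cases hvi : v = i <;> by_cases hwi : w = i
      · rw [hvi, hwi]
      · rw [hvi, Function.update_self, hupd w hwi] at h
        have := hlt w hw hwi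
        omega
      · rw [hwi, Function.update_self, hupd v hvi] at h
        have := hlt v hv hvi
        omega
      · rw [hupd v hvi, hupd w hwi] at h
        exact hyT (Finset.mem_erase.2 ⟨hvi, hv⟩) (Finset.mem_erase.2 ⟨hwi, hw⟩) h
    · by_cases hvi : v = i
      · rw [hvi, Function.update_self]
        omega
      · rw [hupd v hvi]
        have := hlt v hv hvi
        omega
    · rw [Function.update_self]
    · by_cases heij : e = (i, j)
      · rw [heij]
        simp only [Function.update_self]
        rw [hupd j hji, hyj]
      · obtain ⟨heS, h1, h2⟩ := hne e (Finset.mem_erase.2 ⟨heij, he⟩)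
        rw [hupd _ h1, hupd _ h2]
        exact hyS e (Finset.mem_erase.2 ⟨heij, he⟩)
  · rintro ⟨x, hx0, hxT, hxq, hxi, hxS⟩
    refine Subtype.ext ?_
    simp only [Function.update_idem]
    rw [show q = x i by omega, Function.update_eq_self]
  · rintro ⟨y, hy0, hyT, hyq, hyj, hyS⟩
    refine Subtype.ext ?_
    simp only [Function.update_idem]
    rw [← hy0 i (Finset.notMem_erase i T), Function.update_eq_self]

theorem card_circlePlacement_empty {V : Type*} (T : Finset V) (q : ℕ) [NeZero q] :
    Nat.card (CirclePlacement T (∅ : Finset (V × V)) q) = q.descFactorial T.card := by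
  classical
  have e : CirclePlacement T (∅ : Finset (V × V)) q ≃ (T ↪ ZMod q) :=
    { toFun := fun x => ⟨fun v => x.1 v, fun v w h => Subtype.ext (x.2.2.1 v.2 w.2 h)⟩
      invFun := fun f => ⟨fun v => if h : v ∈ T then f ⟨v, h⟩ else 0, by
        refine ⟨fun v hv => by simp [hv], fun v hv w hw h => ?_, by simp⟩
        simp only [Finset.mem_coe.1 hv, Finset.mem_coe.1 hw, dite_true] at h
        exact congrArg Subtype.val (f.injective h)⟩
      left_inv := fun x => by
        refine Subtype.ext (funext fun v => ?_)
        by_cases hv : v ∈ T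
        · simp only [hv, dite_true]
          rfl
        · simp [hv, x.2.1 v hv]
      right_inv := fun f => by
        ext v
        simp }
  rw [Nat.card_congr e, Nat.card_eq_fintype_card, Fintype.card_embedding_eq, Fintype.card_coe,
    ZMod.card]

/-- Induction on `S.card`. The smallest first component `i` is nobody's second component, so the
circle can be cut after `i` and `i` deleted. By the rook condition its partner `j` is then no second
component either, and the circle can be closed up again. Both arguments of `descFactorial` are
unchanged; only the rotation factor changes, from `q + 1` to `q`. -/
theorem card_circlePlacement {V : Type*} [LinearOrder V] {T : Finset V} (hT : T.Nonempty)
    {S : Finset (V × V)} {q : ℕ} (hq : T.card ≤ q) (hS : IsRook S)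
    (hST : ∀ e ∈ S, e.1 ∈ T ∧ e.2 ∈ T) (hlt : ∀ e ∈ S, e.1 < e.2) :
    Nat.card (CirclePlacement T S q) =
      q * (q - 1 - S.card).descFactorial (T.card - 1 - S.card) := by
  have hTpos := hT.card_pos
  induction hk : S.card generalizing T S q with
  | zero =>
    have : NeZero q := ⟨by omega⟩
    rw [Finset.card_eq_zero.1 hk, card_circlePlacement_empty]
    obtain ⟨q, rfl⟩ := Nat.exists_eq_add_of_lt (lt_of_lt_of_le hTpos hq)
    obtain ⟨t, ht⟩ := Nat.exists_eq_add_of_lt hTpos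
    rw [ht]
    simp only [zero_add, Nat.add_sub_cancel, Nat.sub_zero]
    exact Nat.succ_descFactorial_succ _ _
  | succ k ih =>
    have hne : S.Nonempty := Finset.card_pos.1 (by omega)
    obtain ⟨⟨i, j⟩, hij, hmin⟩ := Finset.exists_min_image S Prod.fst hne
    have hi : ∀ e ∈ S, e.2 ≠ i := fun e he h =>
      absurd (hmin e he) (not_le.2 (h ▸ hlt e he))
    have hjT : j ∈ T.erase i := Finset.mem_erase.2 ⟨hi _ hij, (hST _ hij).2⟩
    have hTc : (T.erase i).card + 1 = T.card := Finset.card_erase_add_one (hST _ hij).1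
    have hT'pos : 0 < (T.erase i).card := Finset.card_pos.2 ⟨j, hjT⟩
    obtain ⟨q, rfl⟩ : ∃ q', q = q' + 1 := ⟨q - 1, by omega⟩
    have : NeZero q := ⟨by omega⟩
    have hS' : ∀ e ∈ S.erase (i, j), e ∈ S := fun e he => Finset.mem_of_mem_erase he
    have hST' : ∀ e ∈ S.erase (i, j), e.1 ∈ T.erase i ∧ e.2 ∈ T.erase i := fun e he =>
      ⟨Finset.mem_erase.2 ⟨fun h => (Finset.mem_erase.1 he).1 (hS.1 (hS' e he) hij h),
        (hST e (hS' e he)).1⟩, Finset.mem_erase.2 ⟨hi e (hS' e he), (hST e (hS' e he)).2⟩⟩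
    have hrook : IsRook (S.erase (i, j)) := ⟨hS.1.mono hS', hS.2.mono hS'⟩
    have hrec := ih (q := q) ⟨j, hjT⟩ (by omega) hrook hST' (fun e he => hlt e (hS' e he)) hT'pos
      (by rw [Finset.card_erase_of_mem hij, hk, Nat.add_sub_cancel])
    rw [card_circlePlacement_eq hST' hjT fun e he h => (Finset.mem_erase.1 he).1
      (hS.2 (hS' e he) hij h)] at hrec
    rw [card_circlePlacement_eq hST (hST _ hij).1 hi, card_linePlacement_erase hS hST hij hi,
      Nat.eq_of_mul_eq_mul_left (by omega) hrec]
    congr 2 <;> omega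

/-! ### Set partitions and their arcs. -/

theorem part_eq_part_iff {n : ℕ} (π : Finpartition (Finset.univ : Finset (Fin n))) (i j : Fin n) :
    π.part i = π.part j ↔ i ∈ π.part j :=
  (π.mem_part_iff_part_eq_part (Finset.mem_univ i) (Finset.mem_univ j)).symm

theorem isArc_iff {n : ℕ} {π : Finpartition (Finset.univ : Finset (Fin n))} {i j : Fin n} :
    IsArc π i j ↔ i < j ∧ π.part i = π.part j ∧
      ∀ l, π.part l = π.part j → ¬ (i < l ∧ l < j) := by
  constructor
  · rintro ⟨hlt, B, hB, hi, hj, h⟩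
    rw [π.part_eq_of_mem hB hi, π.part_eq_of_mem hB hj]
    exact ⟨hlt, rfl, fun l hl => h l (hl ▸ π.mem_part (Finset.mem_univ l))⟩
  · rintro ⟨hlt, hij, h⟩
    exact ⟨hlt, π.part j, π.part_mem.2 (Finset.mem_univ j), (part_eq_part_iff π i j).1 hij,
      π.mem_part (Finset.mem_univ j), fun l hl => h l ((part_eq_part_iff π l j).2 hl)⟩

theorem IsArc.left_unique {n : ℕ} {π : Finpartition (Finset.univ : Finset (Fin n))}
    {i i' j : Fin n} (h : IsArc π i j) (h' : IsArc π i' j) : i = i' := by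
  rw [isArc_iff] at h h'
  rcases lt_trichotomy i i' with hlt | rfl | hlt
  · exact (h.2.2 i' h'.2.1 ⟨hlt, h'.1⟩).elim
  · rfl
  · exact (h'.2.2 i h.2.1 ⟨hlt, h.1⟩).elim

theorem IsArc.right_unique {n : ℕ} {π : Finpartition (Finset.univ : Finset (Fin n))}
    {i j j' : Fin n} (h : IsArc π i j) (h' : IsArc π i j') : j = j' := by
  rw [isArc_iff] at h h'
  rcases lt_trichotomy j j' with hlt | rfl | hlt
  · exact (h'.2.2 j (h.2.1.symm.trans h'.2.1) ⟨h.1, hlt⟩).elim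
  · rfl
  · exact (h.2.2 j' (h'.2.1.symm.trans h.2.1) ⟨h'.1, hlt⟩).elim

theorem exists_isArc {n : ℕ} {π : Finpartition (Finset.univ : Finset (Fin n))} {i j : Fin n}
    (hlt : i < j) (h : π.part i = π.part j) : ∃ l, i ≤ l ∧ IsArc π l j := by
  classical
  obtain ⟨l, hl, hmax⟩ := Finset.exists_max_image
    (Finset.univ.filter fun l => l < j ∧ π.part l = π.part j) id ⟨i, by simp [hlt, h]⟩
  simp only [Finset.mem_filter, Finset.mem_univ, true_and, id] at hl hmax
  exact ⟨l, hmax i ⟨hlt, h⟩, isArc_iff.2 ⟨hl.1, hl.2, fun m hm hlm =>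
    absurd (hmax m ⟨hlm.2, hm⟩) (not_le.2 hlm.1)⟩⟩

theorem reflTransGen_isArc {n : ℕ} {π : Finpartition (Finset.univ : Finset (Fin n))} {i j : Fin n}
    (hle : i ≤ j) (h : π.part i = π.part j) : Relation.ReflTransGen (IsArc π) i j := by
  induction j using WellFoundedLT.induction with
  | ind j ih =>
    rcases hle.eq_or_lt with rfl | hlt
    · exact .refl
    · obtain ⟨l, hil, hl⟩ := exists_isArc hlt h
      have hl' := isArc_iff.1 hl
      exact (ih l hl'.1 hil (h.trans hl'.2.1.symm)).tail hl

theorem part_eq_part_of_isArc_imp {n : ℕ} {π π' : Finpartition (Finset.univ : Finset (Fin n))}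
    (hπ : ∀ i j, IsArc π i j → IsArc π' i j) {i j : Fin n} (h : π.part i = π.part j) :
    π'.part i = π'.part j := by
  have key : ∀ {a b}, Relation.ReflTransGen (IsArc π) a b → π'.part a = π'.part b := by
    intro a b hab
    induction hab with
    | refl => rfl
    | tail _ hbc ih => exact ih.trans (isArc_iff.1 (hπ _ _ hbc)).2.1
  rcases le_total i j with hle | hle
  · exact key (reflTransGen_isArc hle h)
  · exact (key (reflTransGen_isArc hle h.symm)).symm

/-- Arcs chain each block together in increasing order, so they determine the blocks. -/
theorem eq_of_isArc_iff {n : ℕ} {π π' : Finpartition (Finset.univ : Finset (Fin n))}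
    (hπ : ∀ i j, IsArc π i j ↔ IsArc π' i j) : π = π' := by
  have hpart : ∀ a, π.part a = π'.part a := by
    intro a
    ext b
    rw [← part_eq_part_iff, ← part_eq_part_iff]
    exact ⟨part_eq_part_of_isArc_imp fun i j => (hπ i j).1,
      part_eq_part_of_isArc_imp fun i j => (hπ i j).2⟩
  ext B
  constructor
  · intro hB
    obtain ⟨a, ha⟩ := π.nonempty_of_mem_parts hB
    rw [← π.part_eq_of_mem hB ha, hpart]
    exact π'.part_mem.2 (Finset.mem_univ a)
  · intro hB
    obtain ⟨a, ha⟩ := π'.nonempty_of_mem_parts hB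
    rw [← π'.part_eq_of_mem hB ha, ← hpart]
    exact π.part_mem.2 (Finset.mem_univ a)

open Classical in
/-- The set of arcs of a set partition. -/
noncomputable def arcs {n : ℕ} (π : Finpartition (Finset.univ : Finset (Fin n))) :
    Finset (Fin n × Fin n) :=
  Finset.univ.filter fun e => IsArc π e.1 e.2

theorem mem_arcs {n : ℕ} {π : Finpartition (Finset.univ : Finset (Fin n))} {e : Fin n × Fin n} :
    e ∈ arcs π ↔ IsArc π e.1 e.2 := by
  simp [arcs]

theorem arcs_injective {n : ℕ} :
    Function.Injective (arcs : Finpartition (Finset.univ : Finset (Fin n)) → _) := fun π π' h =>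
  eq_of_isArc_iff fun i j => by
    rw [← mem_arcs (e := (i, j)), h, mem_arcs]

theorem isRook_arcs {n : ℕ} (π : Finpartition (Finset.univ : Finset (Fin n))) :
    IsRook (arcs π) := by
  constructor
  · rintro ⟨i, j⟩ h ⟨i', j'⟩ h' (rfl : i = i')
    rw [Finset.mem_coe, mem_arcs] at h h'
    exact Prod.ext rfl (h.right_unique h')
  · rintro ⟨i, j⟩ h ⟨i', j'⟩ h' (rfl : j = j')
    rw [Finset.mem_coe, mem_arcs] at h h'
    exact Prod.ext (h.left_unique h') rfl

/-- Every element is either the minimum of its block or the right end of exactly one arc. -/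
theorem card_parts_add_card_arcs {n : ℕ} (π : Finpartition (Finset.univ : Finset (Fin n))) :
    π.parts.card + (arcs π).card = n := by
  classical
  set M := Finset.univ.filter fun j : Fin n => ∀ i, π.part i = π.part j → j ≤ i with hM
  have hpart : M.image π.part = π.parts := by
    ext B
    rw [Finset.mem_image]
    constructor
    · rintro ⟨j, -, rfl⟩
      exact π.part_mem.2 (Finset.mem_univ j)
    · intro hB
      have hne := π.nonempty_of_mem_parts hB
      have hmin := π.part_eq_of_mem hB (B.min'_mem hne)
      refine ⟨B.min' hne, Finset.mem_filter.2 ⟨Finset.mem_univ _, fun i hi => ?_⟩, hmin⟩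
      rw [hmin] at hi
      exact B.min'_le i (hi ▸ π.mem_part (Finset.mem_univ i))
  have h1 : π.parts.card = M.card := by
    rw [← hpart, Finset.card_image_of_injOn]
    intro i hi j hj h
    exact le_antisymm ((Finset.mem_filter.1 hi).2 j h.symm) ((Finset.mem_filter.1 hj).2 i h)
  have h2 : (arcs π).image Prod.snd = Mᶜ := by
    ext j
    rw [Finset.mem_image, Finset.mem_compl, hM, Finset.mem_filter]
    constructor
    · rintro ⟨⟨i, j⟩, he, rfl⟩ hj
      rw [mem_arcs, isArc_iff] at he
      exact absurd (hj.2 i he.2.1) (not_le.2 he.1)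
    · intro hj
      push Not at hj
      obtain ⟨i, hi, hlt⟩ := hj (Finset.mem_univ j)
      obtain ⟨l, -, hl⟩ := exists_isArc hlt hi
      exact ⟨(l, j), mem_arcs.2 hl, rfl⟩
  rw [h1, ← Finset.card_image_of_injOn (isRook_arcs π).2, h2, Finset.card_add_card_compl,
    Fintype.card_fin]

/-- In a rook set every vertex has at most one successor and one predecessor, so `S` is a disjoint
union of increasing paths. These paths are the blocks. -/
theorem exists_arcs_eq {n : ℕ} (S : Finset (Fin n × Fin n)) (hlt : ∀ e ∈ S, e.1 < e.2)
    (hS : IsRook S) : ∃ π : Finpartition (Finset.univ : Finset (Fin n)), arcs π = S := by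
  classical
  let r : Fin n → Fin n → Prop := fun i j => (i, j) ∈ S
  have hru : Relator.RightUnique r := fun i j j' h h' => congrArg Prod.snd (hS.1 h h' rfl)
  have hlu : Relator.RightUnique (Function.swap r) := fun j i i' h h' =>
    congrArg Prod.fst (hS.2 h h' rfl)
  have hle : ∀ {i j}, Relation.ReflTransGen r i j → i ≤ j := by
    intro i j h
    induction h with
    | refl => exact le_rfl
    | tail _ h ih => exact ih.trans (hlt _ h).le
  let s : Setoid (Fin n) :=
    { r := fun i j => Relation.ReflTransGen r i j ∨ Relation.ReflTransGen r j i
      iseqv :=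
        { refl := fun _ => Or.inl .refl
          symm := fun h => h.symm
          trans := by
            rintro a b c (hab | hba) (hbc | hcb)
            · exact Or.inl (hab.trans hbc)
            -- Two paths with a common end are comparable as predecessors are unique; in the next
            -- case two paths with a common start are, as successors are unique.
            · have := Relation.ReflTransGen.total_of_right_unique hlu hab.swap hcb.swap
              rcases this with h | h
              · exact Or.inr (Relation.reflTransGen_swap.1 h)
              · exact Or.inl (Relation.reflTransGen_swap.1 h)
            · exact Relation.ReflTransGen.total_of_right_unique hru hba hbc
            · exact Or.inr (hcb.trans hba) } }
  have hpart : ∀ i j, (Finpartition.ofSetoid s).part i = (Finpartition.ofSetoid s).part j ↔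
      (Relation.ReflTransGen r i j ∨ Relation.ReflTransGen r j i) := by
    intro i j
    rw [part_eq_part_iff, Finpartition.mem_part_ofSetoid_iff_rel]
    exact or_comm
  refine ⟨Finpartition.ofSetoid s, ?_⟩
  ext ⟨i, j⟩
  rw [mem_arcs, isArc_iff]
  simp only [hpart]
  constructor
  · rintro ⟨hij, h, hl⟩
    have h : Relation.ReflTransGen r i j := h.resolve_right fun h => absurd (hle h) (not_le.2 hij)
    -- If the first step of the path from `i` missed `j`, it would land strictly between `i` and `j`
    -- in the same block.
    rcases Relation.ReflTransGen.cases_head h with h | ⟨l, hil, hlj⟩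
    · exact absurd h hij.ne
    · rcases (hle hlj).eq_or_lt with rfl | hlt'
      · exact hil
      · exact absurd ⟨hlt _ hil, hlt'⟩ (hl l (Or.inl hlj))
  · intro h
    refine ⟨hlt _ h, Or.inl (.single h), ?_⟩
    rintro l hl ⟨hil, hlj⟩
    have hl : Relation.ReflTransGen r l j := hl.resolve_right fun h => absurd (hle h) (not_le.2 hlj)
    rcases Relation.ReflTransGen.cases_tail hl with h' | ⟨m, hlm, hmj⟩
    · exact absurd h' hlj.ne'
    · obtain rfl : m = i := hlu hmj h
      exact absurd (hle hlm) (not_le.2 hil)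

/-! ### Stirling numbers as rook counts, and the resulting polynomial. -/

open Classical in
/-- The edges `ij` of `G`, as the pairs with `i < j`. -/
noncomputable def edgePairs {n : ℕ} (G : SimpleGraph (Fin n)) : Finset (Fin n × Fin n) :=
  Finset.univ.filter fun e => e.1 < e.2 ∧ G.Adj e.1 e.2

theorem mem_edgePairs {n : ℕ} {G : SimpleGraph (Fin n)} {e : Fin n × Fin n} :
    e ∈ edgePairs G ↔ e.1 < e.2 ∧ G.Adj e.1 e.2 := by
  simp [edgePairs]

open Classical in
theorem stir_eq_card_rook {n : ℕ} (G : SimpleGraph (Fin n)) {k : ℕ} (hk : k < n) :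
    stir G (n - k) = ((edgePairs G).powerset.filter fun S => IsRook S ∧ S.card = k).card := by
  rw [stir, ← Fintype.card_coe, ← Nat.card_eq_fintype_card]
  refine Nat.card_congr (Equiv.ofBijective (fun π => ⟨arcs π.1, ?_⟩) ⟨?_, ?_⟩)
  · rw [Finset.mem_filter, Finset.mem_powerset]
    refine ⟨fun e he => ?_, isRook_arcs _, ?_⟩
    · rw [mem_arcs] at he
      exact mem_edgePairs.2 ⟨he.1, π.2.1 _ _ he⟩
    · have := card_parts_add_card_arcs π.1
      have := π.2.2
      omega
  · intro π π' h
    exact Subtype.ext (arcs_injective (congrArg Subtype.val h))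
  · rintro ⟨S, hS⟩
    rw [Finset.mem_filter, Finset.mem_powerset] at hS
    obtain ⟨hSE, hrook, hcard⟩ := hS
    obtain ⟨π, rfl⟩ := exists_arcs_eq S (fun e he => (mem_edgePairs.1 (hSE he)).1) hrook
    refine ⟨⟨π, fun i j hij => ?_, ?_⟩, rfl⟩
    · exact (mem_edgePairs.1 (hSE (mem_arcs.2 hij : (i, j) ∈ arcs π))).2
    · have := card_parts_add_card_arcs π
      omega

/-- The corresponding partition has at least one block; this is why the sum stops at `k = n - 1`. -/
theorem IsRook.card_lt {n : ℕ} [NeZero n] {S : Finset (Fin n × Fin n)}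
    (hlt : ∀ e ∈ S, e.1 < e.2) (hS : IsRook S) : S.card < n := by
  obtain ⟨π, rfl⟩ := exists_arcs_eq S hlt hS
  have h := card_parts_add_card_arcs π
  have : 0 < π.parts.card := Finset.card_pos.2 ⟨_, π.part_mem.2 (Finset.mem_univ 0)⟩
  omega

open Polynomial in
/-- The right-hand side of the formula for the characteristic polynomials. -/
noncomputable def stirPoly {n : ℕ} (G : SimpleGraph (Fin n)) : ℤ[X] :=
  X * ∑ k ∈ Finset.range n, (-1) ^ k * (stir G (n - k) : ℤ[X]) *
    ∏ i ∈ Finset.Ico (k + 1) n, (X - (i : ℤ[X]))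

theorem prod_Ico_sub_eq_descFactorial {n p k : ℕ} (hp : n ≤ p) (hk : k < n) :
    ∏ i ∈ Finset.Ico (k + 1) n, ((p : ℤ) - i) =
      ((p - 1 - k).descFactorial (n - 1 - k) : ℕ) := by
  rw [Nat.descFactorial_eq_prod_range, Finset.prod_Ico_eq_prod_range, Nat.cast_prod,
    show n - (k + 1) = n - 1 - k by omega]
  refine Finset.prod_congr rfl fun i hi => ?_
  have := Finset.mem_range.1 hi
  omega

theorem eval_stirPoly {n : ℕ} (G : SimpleGraph (Fin n)) {p : ℕ} (hp : n ≤ p) :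
    (stirPoly G).eval (p : ℤ) = p * ∑ k ∈ Finset.range n, (-1) ^ k * (stir G (n - k) : ℤ) *
      ((p - 1 - k).descFactorial (n - 1 - k) : ℕ) := by
  rw [stirPoly, Polynomial.eval_mul, Polynomial.eval_X, Polynomial.eval_finsetSum]
  congr 1
  refine Finset.sum_congr rfl fun k hk => ?_
  rw [← prod_Ico_sub_eq_descFactorial hp (Finset.mem_range.1 hk), Polynomial.eval_mul,
    Polynomial.eval_prod]
  simp

/-- If rook sets of constraints are satisfied equally often and others never, inclusion–exclusion
gives `stirPoly`. -/
theorem eq_eval_stirPoly {n q : ℕ} [NeZero n] [NeZero q] (G : SimpleGraph (Fin n)) (hq : n ≤ q)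
    (P : Fin n × Fin n → (Fin n → ZMod q) → Prop)
    (hrook : ∀ S ⊆ edgePairs G, IsRook S →
      Nat.card {x : Fin n → ZMod q // Function.Injective x ∧ ∀ e ∈ S, P e x} =
        q * (q - 1 - S.card).descFactorial (n - 1 - S.card))
    (hnot : ∀ S ⊆ edgePairs G, ¬ IsRook S →
      ∀ x : Fin n → ZMod q, Function.Injective x → ¬ ∀ e ∈ S, P e x) :
    (Nat.card {x : Fin n → ZMod q // Function.Injective x ∧ ∀ e ∈ edgePairs G, ¬ P e x} : ℤ) =
      (stirPoly G).eval (q : ℤ) := by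
  classical
  rw [card_forall_not, eval_stirPoly G hq, Finset.mul_sum]
  have h1 : ∀ S ∈ (edgePairs G).powerset,
      (-1 : ℤ) ^ S.card * (Nat.card {x : Fin n → ZMod q // Function.Injective x ∧ ∀ e ∈ S, P e x} : ℤ) =
      if IsRook S then (-1 : ℤ) ^ S.card *
        (q * (q - 1 - S.card).descFactorial (n - 1 - S.card) : ℕ) else 0 := by
    intro S hS
    rw [Finset.mem_powerset] at hS
    split_ifs with hr
    · rw [← hrook S hS hr]
    · have : IsEmpty {x : Fin n → ZMod q // Function.Injective x ∧ ∀ e ∈ S, P e x} :=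
        ⟨fun x => hnot S hS hr x.1 x.2.1 x.2.2⟩
      rw [Nat.card_of_isEmpty, Nat.cast_zero, mul_zero]
  rw [Finset.sum_congr rfl h1, ← Finset.sum_filter,
    ← Finset.sum_fiberwise_of_maps_to (t := Finset.range n) (g := Finset.card)]
  · refine Finset.sum_congr rfl fun k hk => ?_
    rw [Finset.filter_filter, stir_eq_card_rook G (Finset.mem_range.1 hk)]
    rw [Finset.sum_congr rfl (g := fun _ => (-1 : ℤ) ^ k *
      (q * (q - 1 - k).descFactorial (n - 1 - k) : ℕ)), Finset.sum_const, nsmul_eq_mul]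
    · push_cast
      ring
    · intro S hS
      rw [(Finset.mem_filter.1 hS).2.2]
  · intro S hS
    rw [Finset.mem_filter, Finset.mem_powerset] at hS
    exact Finset.mem_range.2 (hS.2.card_lt fun e he => (mem_edgePairs.1 (hS.1 he)).1)

theorem eq_of_eval_eq_of_lt {f g : Polynomial ℤ} (N : ℕ)
    (h : ∀ q : ℕ, N < q → f.eval (q : ℤ) = g.eval (q : ℤ)) : f = g := by
  refine Polynomial.eq_of_infinite_eval_eq f g
    (Set.infinite_of_injective_forall_mem (f := fun m : ℕ => ((m + N + 1 : ℕ) : ℤ)) ?_ ?_)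
  · intro a b hab
    simp only at hab
    omega
  · intro m
    exact h _ (by omega)

theorem injective_iff_sub_ne_zero {n q : ℕ} (z : Fin n → ZMod q) :
    Function.Injective z ↔ ∀ i j, i < j → z i - z j ≠ 0 := by
  constructor
  · intro h i j hij h0
    exact hij.ne (h (sub_eq_zero.1 h0))
  · intro h i j hij
    rcases lt_trichotomy i j with hlt | rfl | hlt
    · exact (h i j hlt (sub_eq_zero.2 hij)).elim
    · rfl
    · exact (h j i hlt (sub_eq_zero.2 hij.symm)).elim

/-! ### The Shi and Ish arrangements. -/

theorem charPoly_shi {n : ℕ} [NeZero n] (G : SimpleGraph (Fin n)) :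
    charPoly (shi G) = stirPoly G := by
  classical
  have hn := NeZero.pos n
  -- The constants are only `0` and `1`, so `K = n` is generous; any bound serves, since infinitely
  -- many `q` suffice.
  refine eq_of_eval_eq_of_lt (n * n) fun q hq => ?_
  have hnq : n < q := lt_of_le_of_lt (Nat.le_mul_of_pos_left n hn) hq
  have : NeZero q := ⟨by omega⟩
  rw [← eq_eval_stirPoly G hnq.le (fun e x => x e.1 = x e.2 + 1),
    charPoly_eval_eq_card_zmod hq (shi G) ({e | e.1 < e.2.1 ∧ e.2.2 = 0} ∪
      {e | (e.1 < e.2.1 ∧ G.Adj e.1 e.2.1) ∧ e.2.2 = 1})]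
  · refine congrArg _ (Nat.card_congr (Equiv.subtypeEquivRight fun z => ?_))
    rw [injective_iff_sub_ne_zero]
    constructor
    · intro h
      refine ⟨fun i j hij => ?_, fun e he hz => ?_⟩
      · simpa using h (i, j, 0) (Or.inl ⟨hij, rfl⟩)
      · refine h (e.1, e.2, 1) (Or.inr ⟨mem_edgePairs.1 he, rfl⟩) ?_
        push_cast
        linear_combination hz
    · rintro ⟨h1, h2⟩ ⟨i, j, c⟩ (⟨hij, rfl⟩ | ⟨hij, rfl⟩)
      · simpa using h1 i j hij
      · intro hz
        push_cast at hz
        exact h2 (i, j) (mem_edgePairs.2 hij) (by linear_combination hz)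
  · rintro ⟨i, j, c⟩ (⟨hij, rfl⟩ | ⟨⟨hij, -⟩, rfl⟩)
    · exact ⟨hij.ne, by simp⟩
    · exact ⟨hij.ne, by simpa using Nat.one_le_iff_ne_zero.2 hn.ne'⟩
  · ext H
    simp only [shi, coxeter, arrangement, Finset.coe_union, Finset.coe_image, Set.image_union,
      Finset.coe_filter, Finset.mem_univ, true_and]
    refine or_congr ?_ ?_
    · constructor
      · rintro ⟨e, he, rfl⟩
        exact ⟨(e.1, e.2, 0), ⟨he, rfl⟩, by simp⟩
      · rintro ⟨⟨i, j, c⟩, ⟨he, rfl⟩, rfl⟩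
        exact ⟨(i, j), he, by simp⟩
    · constructor
      · rintro ⟨e, he, rfl⟩
        exact ⟨(e.1, e.2, 1), ⟨he, rfl⟩, by simp⟩
      · rintro ⟨⟨i, j, c⟩, ⟨he, rfl⟩, rfl⟩
        exact ⟨(i, j), he, by simp⟩
  · intro S hSE hS
    have hlt : ∀ e ∈ S, e.1 < e.2 := fun e he => (mem_edgePairs.1 (hSE he)).1
    have := card_circlePlacement (T := Finset.univ) (q := q) ⟨0, Finset.mem_univ _⟩
      (by simpa using hnq.le) hS (by simp) hlt
    rw [Finset.card_univ, Fintype.card_fin] at this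
    rw [← this]
    refine Nat.card_congr (Equiv.subtypeEquivRight fun x => ?_)
    simp [Set.injOn_univ]
  -- Two edges sharing one end force equal values of `x` at their other ends.
  · intro S hSE hS x hx h
    refine hS ⟨fun e he f hf hef => ?_, fun e he f hf hef => ?_⟩
    · refine Prod.ext hef (hx ?_)
      have h1 := h e he
      have h2 := h f hf
      rw [hef] at h1
      linear_combination h2 - h1
    · refine Prod.ext (hx ?_) hef
      rw [h e he, h f hf, hef]

theorem charPoly_ish {n : ℕ} [NeZero n] (G : SimpleGraph (Fin n)) :
    charPoly (ish G) = stirPoly G := by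
  classical
  have hn := NeZero.pos n
  refine eq_of_eval_eq_of_lt (n * n) fun q hq => ?_
  have hnq : n < q := lt_of_le_of_lt (Nat.le_mul_of_pos_left n hn) hq
  have : NeZero q := ⟨by omega⟩
  have hpos : ∀ {i j : Fin n}, i < j → 0 < j := fun {i j} h => lt_of_le_of_lt (Fin.zero_le i) h
  rw [← eq_eval_stirPoly G hnq.le (fun e x => x 0 - x e.2 = ((e.1 : ℕ) + 1 : ℕ)),
    charPoly_eval_eq_card_zmod hq (ish G) ({e | e.1 < e.2.1 ∧ e.2.2 = 0} ∪
      (fun e : Fin n × Fin n => (0, e.2, ((e.1 : ℕ) + 1 : ℤ))) '' edgePairs G)]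
  · refine congrArg _ (Nat.card_congr (Equiv.subtypeEquivRight fun z => ?_))
    rw [injective_iff_sub_ne_zero]
    constructor
    · intro h
      refine ⟨fun i j hij => ?_, fun e he hz => ?_⟩
      · simpa using h (i, j, 0) (Or.inl ⟨hij, rfl⟩)
      · refine h (0, e.2, (e.1 : ℕ) + 1) (Or.inr ⟨e, he, rfl⟩) ?_
        push_cast at hz ⊢
        exact hz
    · rintro ⟨h1, h2⟩ ⟨i, j, c⟩ (⟨hij, rfl⟩ | ⟨e, he, heq⟩)
      · simpa using h1 i j hij
      · rw [← heq]
        have := h2 e he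
        push_cast at this ⊢
        exact this
  · rintro ⟨i, j, c⟩ (⟨hij, rfl⟩ | ⟨e, he, heq⟩)
    · exact ⟨hij.ne, by simp⟩
    · rw [← heq]
      refine ⟨(hpos (mem_edgePairs.1 he).1).ne, ?_⟩
      have := e.1.2
      simp only
      rw [abs_of_nonneg (by positivity)]
      omega
  · ext H
    simp only [ish, coxeter, arrangement, Finset.coe_union, Finset.coe_image, Set.image_union,
      Finset.coe_filter, Finset.mem_univ, true_and, Set.image_image]
    refine or_congr ?_ ?_
    · constructor
      · rintro ⟨e, he, rfl⟩
        exact ⟨(e.1, e.2, 0), ⟨he, rfl⟩, by simp⟩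
      · rintro ⟨⟨i, j, c⟩, ⟨he, rfl⟩, rfl⟩
        exact ⟨(i, j), he, by simp⟩
    · constructor
      · rintro ⟨e, he, rfl⟩
        exact ⟨e, mem_edgePairs.2 he, by simp⟩
      · rintro ⟨e, he, rfl⟩
        exact ⟨e, mem_edgePairs.1 he, by simp⟩
  · intro S hSE hS
    exact card_ish_constraints hnq S (fun e he => (mem_edgePairs.1 (hSE he)).1) hS
  · intro S hSE hS x hx h
    refine hS ⟨fun e he f hf hef => ?_, fun e he f hf hef => ?_⟩
    · refine Prod.ext hef (hx ?_)
      have h1 := h e he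
      have h2 := h f hf
      rw [hef] at h1
      linear_combination h2 - h1
    -- Here the offsets `e.1 + 1` and `f.1 + 1` agree mod `q`; both are at most `n < q`, hence
    -- equal.
    · refine Prod.ext ?_ hef
      have h1 := h e he
      rw [hef, h f hf] at h1
      have := natCast_zmod_inj (by omega) (by omega) h1
      exact Fin.ext (by omega)

end ShiIsh

theorem mainTheorem2 (n : ℕ) [NeZero n] (G : SimpleGraph (Fin n)) :
    ShiIsh.charPoly (ShiIsh.shi G) = ShiIsh.charPoly (ShiIsh.ish G) ∧
    ShiIsh.charPoly (ShiIsh.ish G) =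
      Polynomial.X * ∑ k ∈ Finset.range n,
        (-1) ^ k * (ShiIsh.stir G (n - k) : Polynomial ℤ) *
          ∏ i ∈ Finset.Ico (k + 1) n, (Polynomial.X - (i : Polynomial ℤ)) ∧
    ∀ p : ℕ, n ≤ p →
      (((ShiIsh.charPoly (ShiIsh.ish G)).eval (p : ℤ) : ℤ) : ℚ) =
        p * ∑ k ∈ Finset.range n,
          (-1) ^ k * (ShiIsh.stir G (n - k) : ℚ) *
            ((Nat.factorial (p - k - 1) : ℚ) / (Nat.factorial (p - n) : ℚ)) := by
  refine ⟨(ShiIsh.charPoly_shi G).trans (ShiIsh.charPoly_ish G).symm, ShiIsh.charPoly_ish G,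
    fun p hp => ?_⟩
  rw [ShiIsh.charPoly_ish, ShiIsh.eval_stirPoly G hp]
  push_cast
  congr 1
  refine Finset.sum_congr rfl fun k hk => ?_
  have hk := Finset.mem_range.1 hk
  congr 1
  rw [eq_div_iff (by positivity), mul_comm]
  have := Nat.factorial_mul_descFactorial (show n - 1 - k ≤ p - 1 - k by omega)
  rw [show p - 1 - k - (n - 1 - k) = p - n by omega, show p - 1 - k = p - k - 1 by omega] at this
  rw [show p - 1 - k = p - k - 1 by omega]
  exact_mod_cast this
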